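/- Let $n\ge 0$ and let $\mathcal H_n$ be the real vector space of $n\times n$ Hermitian matrices; its real dimension is $n^2$. (a) Let $k_1,\dots,k_I\ge 1$ be integers with $k_1+\dots+k_I=n$. The set of all $A\in\mathcal H_n$ that have exactly $I$ distinct eigenvalues, with multiplicities $k_1,\dots,k_I$, is a nonempty embedded $C^\infty$ submanifold of $\mathcal H_n$ of real dimension $n^2-\sum_{i=1}^I(k_i^2-1)$, hence of real codimension $\sum_{i=1}^I(k_i^2-1)$: near each of its points it is given by the vanishing of $\sum_{i=1}^I(k_i^2-1)$ functions belonging to a smooth coordinate system of $\mathcal H_n$. Its Hausdorff dimension is $n^2-\sum_{i=1}^I(k_i^2-1)$ as well. (b) Let $1\le k\le n$. The minimum of $\sum_{i=1}^I(k_i^2-1)$ over all $I$ and all integers $k_1,\dots,k_I\ge 1$ with $k_1+\dots+k_I=n$ and $k_i=k$ for some $i$ is $k^2-1$. The set of all $A\in\mathcal H_n$ with one eigenvalue of multiplicity $k$ and $n-k$ further eigenvalues, all simple and distinct, is a nonempty embedded $C^\infty$ submanifold of $\mathcal H_n$ of real dimension $n^2-(k^2-1)$ and real codimension $k^2-1$.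 The set of all $A\in\mathcal H_n$ that have some eigenvalue of multiplicity exactly $k$ (the others being arbitrary) has Hausdorff dimension $n^2-(k^2-1)$, that is, codimension $k^2-1$ in $\mathcal H_n$: a $k$-fold eigenvalue requires $k^2-1$ real conditions. -/

import Mathlib

open scoped ContDiff

/- Spaces of complex matrices carry the Frobenius norm (all norms on them are equivalent). -/
attribute [local instance] Matrix.frobeniusNormedAddCommGroup Matrix.frobeniusNormedSpace

/-- The real vector space of Hermitian matrices of order `n` (complex matrices with `A* = A`). -/
noncomputable abbrev HermitianMatrices (n : ℕ) : Submodule ℝ (Matrix (Fin n) (Fin n) ℂ) :=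
  selfAdjoint.submodule ℝ (Matrix (Fin n) (Fin n) ℂ)

/-- `S` is an embedded smooth submanifold of `E`, of dimension `d` and codimension `c` at each of
its points: around every point of `S` there are smooth coordinates of `E` with values in
`ℝ^d × ℝ^c` in which `S` is given by the vanishing of the last `c` coordinates, that is, by `c`
independent real conditions. (The empty set is not excluded here.) -/
def IsEmbeddedSubmanifold {E : Type*} [NormedAddCommGroup E] [NormedSpace ℝ E]
    (S : Set E) (d c : ℕ) : Prop :=
  ∀ p ∈ S, ∃ φ : OpenPartialHomeomorph E (EuclideanSpace ℝ (Fin d) × EuclideanSpace ℝ (Fin c)),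
    p ∈ φ.source ∧
    ContDiffOn ℝ ∞ φ φ.source ∧
    ContDiffOn ℝ ∞ φ.symm φ.target ∧
    ∀ x ∈ φ.source, (x ∈ S ↔ (φ x).2 = 0)

/-- The matrix `A` has exactly `I` distinct eigenvalues `μ 0, …, μ (I - 1)`, and these have
multiplicities `k 0, …, k (I - 1)` (meant for positive `k i`). -/
def HasEigenvalueMultiplicities {n I : ℕ} (A : Matrix (Fin n) (Fin n) ℂ) (k : Fin I → ℕ) : Prop :=
  ∃ μ : Fin I → ℂ, Function.Injective μ ∧
    A.charpoly = ∏ i, (Polynomial.X - Polynomial.C (μ i)) ^ k i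

/-- The Hermitian matrices of order `n` having `I` distinct eigenvalues with multiplicities
`k 0, …, k (I - 1)`. -/
def hermitianStratum (n : ℕ) {I : ℕ} (k : Fin I → ℕ) : Set (HermitianMatrices n) :=
  {A | HasEigenvalueMultiplicities (A : Matrix (Fin n) (Fin n) ℂ) k}

/-- The Hermitian matrices of order `n` having a `k`-fold eigenvalue (`k ≥ 1`), with no condition
on the other eigenvalues. -/
def hermitianWithFoldEigenvalue (n k : ℕ) : Set (HermitianMatrices n) :=
  {A | ∃ μ : ℂ, (A : Matrix (Fin n) (Fin n) ℂ).charpoly.rootMultiplicity μ = k}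

/-! Write A = U D U* with D diagonal, the entry at a being l (f a), where l is injective and the
fibres of `f` have sizes k_i. For Hermitian X let B(X) be the block-diagonal part and K(X) the
skew-Hermitian matrix with entries X_ab / (l (f b) - l (f a)) outside the blocks. The map Ψ(X) = U
exp(K) B exp(K)* U* sends D to A. Since [K(H), D] is the off-block part of H, the derivative of Ψ at
D is H ↦ U H U*, which is invertible (`hasFDerivAt_blockConjugation`). So Ψ is a local
diffeomorphism at D, and Ψ(X) always has the spectrum of B(X).

Near D the Gershgorin discs of different blocks are disjoint, so different blocks of B(X) share no
eigenvalue. If there are only I eigenvalues in all, each of the I blocks has a single one and, being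
Hermitian, is scalar (`eventually_hasEigenvalueMultiplicities_iff`). Hence the local inverse of Ψ
flattens the stratum to the linear space `scalarBlocks f`. There the k_i² real parameters of each
block shrink to one, which gives the codimension.

Smooth charts preserve Hausdorff dimension. The matrices with a k-fold eigenvalue form a countable
union of strata, and the stratum whose other eigenvalues are simple has the largest dimension. -/

open Topology Filter Module

/-! ### Submanifold charts from linear coordinates and the inverse function theorem. -/

/-- A subspace is the kernel of the second component of suitable linear coordinates. -/
theorem Submodule.exists_prod_coordinates {E : Type*} [NormedAddCommGroup E] [NormedSpace ℝ E]
    [FiniteDimensional ℝ E] (W : Submodule ℝ E) {d c : ℕ} (hW : finrank ℝ W = d)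
    (hE : finrank ℝ E = d + c) :
    ∃ L : E ≃L[ℝ] EuclideanSpace ℝ (Fin d) × EuclideanSpace ℝ (Fin c),
      ∀ x, x ∈ W ↔ (L x).2 = 0 := by
  obtain ⟨W', hc⟩ := W.exists_isCompl
  have hW' : finrank ℝ W' = c := by
    have := Submodule.finrank_add_eq_of_isCompl hc
    omega
  let e₁ : W ≃ₗ[ℝ] EuclideanSpace ℝ (Fin d) := LinearEquiv.ofFinrankEq _ _ (by simp [hW])
  let e₂ : W' ≃ₗ[ℝ] EuclideanSpace ℝ (Fin c) := LinearEquiv.ofFinrankEq _ _ (by simp [hW'])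
  let L := (W.prodEquivOfIsCompl W' hc).symm.trans (e₁.prodCongr e₂)
  refine ⟨L.toContinuousLinearEquiv, fun x => ?_⟩
  have : (L.toContinuousLinearEquiv x).2 = e₂ ((W.prodEquivOfIsCompl W' hc).symm x).2 := rfl
  rw [this, LinearEquiv.map_eq_zero_iff, Submodule.prodEquivOfIsCompl_symm_apply_snd_eq_zero]

/-- A smooth map `Ψ` with invertible derivative at `x₀` that straightens `S` near `Ψ x₀` to a
subspace gives submanifold coordinates of `S` at `Ψ x₀`. -/
theorem exists_submanifold_chart {E : Type*} [NormedAddCommGroup E] [NormedSpace ℝ E]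
    [FiniteDimensional ℝ E] {S : Set E} {Ψ : E → E} {x₀ : E} {e : E ≃L[ℝ] E}
    (hΨ : ContDiff ℝ ∞ Ψ) (he : HasFDerivAt Ψ (e : E →L[ℝ] E) x₀) {W : Submodule ℝ E} {d c : ℕ}
    (hW : finrank ℝ W = d) (hE : finrank ℝ E = d + c)
    (hS : ∀ᶠ x in 𝓝 x₀, (Ψ x ∈ S ↔ x ∈ W)) :
    ∃ φ : OpenPartialHomeomorph E (EuclideanSpace ℝ (Fin d) × EuclideanSpace ℝ (Fin c)),
      Ψ x₀ ∈ φ.source ∧ ContDiffOn ℝ ∞ φ φ.source ∧ ContDiffOn ℝ ∞ φ.symm φ.target ∧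
      ∀ x ∈ φ.source, (x ∈ S ↔ (φ x).2 = 0) := by
  have : CompleteSpace E := FiniteDimensional.complete ℝ E
  obtain ⟨L, hL⟩ := W.exists_prod_coordinates hW hE
  let h := (hΨ.contDiffAt (x := x₀)).toOpenPartialHomeomorph Ψ he (by simp)
  have hx₀ : x₀ ∈ h.source :=
    (hΨ.contDiffAt (x := x₀)).mem_toOpenPartialHomeomorph_source he (by simp)
  have hh : (h : E → E) = Ψ := rfl
  have hder : ∀ᶠ x in 𝓝 x₀, fderiv ℝ Ψ x ∈ Set.range ((↑) : (E ≃L[ℝ] E) → E →L[ℝ] E) := by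
    refine (hΨ.continuous_fderiv (by simp)).continuousAt.eventually
      (ContinuousLinearEquiv.isOpen.mem_nhds ?_)
    exact ⟨e, he.fderiv.symm⟩
  obtain ⟨U, hU, hUo, hxU⟩ := eventually_nhds_iff.1 (hder.and hS)
  -- The inverse function theorem controls the inverse near one point only; on `U` the derivative is
  -- invertible everywhere, so the inverse is smooth on the whole target.
  let g := h.restrOpen U hUo
  have hg : (g : E → E) = Ψ := rfl
  have hgU : ∀ x ∈ g.source, x ∈ U := fun x hx => by
    rw [OpenPartialHomeomorph.restrOpen_source] at hx; exact hx.2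
  have hgx : x₀ ∈ g.source := by
    rw [OpenPartialHomeomorph.restrOpen_source]; exact ⟨hx₀, hxU⟩
  have hgsymm : ContDiffOn ℝ ∞ g.symm g.target := by
    intro y hy
    obtain ⟨e', he'⟩ := (hU _ (hgU _ (g.map_target hy))).1
    refine (g.contDiffAt_symm hy (f₀' := e') ?_ ?_).contDiffWithinAt
    · rw [he', hg]
      exact (hΨ.differentiable (by simp) _).hasFDerivAt
    · rw [hg]; exact hΨ.contDiffAt
  refine ⟨g.symm.transHomeomorph L.toHomeomorph, ?_, ?_, ?_, ?_⟩
  · exact g.map_source hgx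
  · exact L.contDiff.comp_contDiffOn hgsymm
  · have : (g.symm.transHomeomorph L.toHomeomorph).symm = Ψ ∘ L.symm := rfl
    rw [this]
    exact (hΨ.comp L.symm.contDiff).contDiffOn
  · intro x hx
    have hx' : x ∈ g.target := hx
    have h1 := (hU _ (hgU _ (g.map_target hx'))).2
    rw [← hg, g.right_inv hx'] at h1
    exact h1.trans (hL _)

/-! ### Hausdorff dimension of embedded submanifolds. -/

/-- The Hausdorff dimension of a nonempty embedded submanifold is its dimension. -/
theorem IsEmbeddedSubmanifold.dimH_eq {E : Type*} [NormedAddCommGroup E] [NormedSpace ℝ E]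
    [FiniteDimensional ℝ E] {S : Set E} {d c : ℕ} (hS : IsEmbeddedSubmanifold S d c)
    (hne : S.Nonempty) : dimH S = d := by
  have : CompleteSpace E := FiniteDimensional.complete ℝ E
  have : ProperSpace E := FiniteDimensional.proper_real E
  have hV : dimH (Set.univ : Set (EuclideanSpace ℝ (Fin d))) = d := by
    rw [Real.dimH_univ_eq_finrank]; simp
  let ι : EuclideanSpace ℝ (Fin d) →L[ℝ] EuclideanSpace ℝ (Fin d) × EuclideanSpace ℝ (Fin c) :=
    ContinuousLinearMap.inl ℝ _ _
  apply le_antisymm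
  -- A dimension above d would be attained in every neighbourhood of some p, but near p the set lies
  -- in a smooth image of a piece of ℝ^d. Balls are used because the dimension bound for C¹ images
  -- is applied on convex sets.
  · by_contra! hlt
    obtain ⟨p, hp, hpt⟩ := exists_mem_nhdsWithin_lt_dimH_of_lt_dimH hlt
    obtain ⟨φ, hpφ, -, hφ', hφS⟩ := hS p hp
    obtain ⟨r, hr, hball⟩ := Metric.isOpen_iff.1 φ.open_target _ (φ.map_source hpφ)
    let t : Set E := φ.source ∩ φ ⁻¹' Metric.ball (φ p) r
    have ht : t ∈ 𝓝 p := (φ.isOpen_inter_preimage Metric.isOpen_ball).mem_nhds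
      ⟨hpφ, Metric.mem_ball_self hr⟩
    refine (hpt (S ∩ t) (inter_mem_nhdsWithin S ht)).not_ge ?_
    let Z := Metric.ball (φ p) r ∩ Set.range ι
    have hsub : S ∩ t ⊆ φ.symm '' Z := by
      rintro x ⟨hxS, hxs, hxb⟩
      refine ⟨φ x, ⟨hxb, (φ x).1, ?_⟩, φ.left_inv hxs⟩
      exact Prod.ext rfl ((hφS x hxs).1 hxS).symm
    calc dimH (S ∩ t) ≤ dimH (φ.symm '' Z) := dimH_mono hsub
      _ ≤ dimH Z := ((hφ'.mono hball).of_le (by simp)).dimH_image_le (convex_ball _ _)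
          Set.inter_subset_left
      _ ≤ dimH (Set.range ι) := dimH_mono Set.inter_subset_right
      _ ≤ dimH (Set.univ : Set (EuclideanSpace ℝ (Fin d))) := ι.lipschitz.dimH_range_le
      _ = d := hV
  -- Conversely, the chart followed by the first projection maps a small piece of `S` onto a set
  -- containing a nonempty open subset of ℝ^d, without raising dimension.
  · obtain ⟨p, hp⟩ := hne
    obtain ⟨φ, hpφ, hφ, -, hφS⟩ := hS p hp
    obtain ⟨r, hr, hball⟩ := Metric.isOpen_iff.1 φ.open_source _ hpφ
    let T : Set (EuclideanSpace ℝ (Fin d)) :=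
      ι ⁻¹' (φ.target ∩ φ.symm ⁻¹' Metric.ball p r)
    have hTo : IsOpen T := (φ.isOpen_inter_preimage_symm Metric.isOpen_ball).preimage ι.continuous
    have hpT : (φ p).1 ∈ T := by
      have : ι (φ p).1 = φ p := Prod.ext rfl ((hφS p hpφ).1 hp).symm
      rw [Set.mem_preimage, this]
      refine ⟨φ.map_source hpφ, ?_⟩
      rw [Set.mem_preimage, φ.left_inv hpφ]
      exact Metric.mem_ball_self hr
    have hT : T ⊆ Prod.fst '' (φ '' (S ∩ Metric.ball p r)) := by
      rintro y ⟨hy, hyb⟩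
      refine ⟨_, ⟨φ.symm (ι y), ⟨?_, hyb⟩, φ.right_inv hy⟩, rfl⟩
      rw [hφS _ (φ.map_target hy), φ.right_inv hy]
      rfl
    calc (d : ENNReal) = dimH T := by
          rw [Real.dimH_of_mem_nhds (hTo.mem_nhds hpT)]; simp
      _ ≤ dimH (Prod.fst '' (φ '' (S ∩ Metric.ball p r))) := dimH_mono hT
      _ ≤ dimH (φ '' (S ∩ Metric.ball p r)) := LipschitzWith.prod_fst.dimH_image_le _
      _ ≤ dimH (S ∩ Metric.ball p r) := ((hφ.mono hball).of_le (by simp)).dimH_image_le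
          (convex_ball _ _) Set.inter_subset_right
      _ ≤ dimH S := dimH_mono Set.inter_subset_left

/-! ### Dimension count for Hermitian matrices with scalar blocks. -/

theorem HermitianMatrices.star_apply {n : ℕ} (X : HermitianMatrices n) (a b : Fin n) :
    star ((X : Matrix (Fin n) (Fin n) ℂ) a b) = (X : Matrix (Fin n) (Fin n) ℂ) b a :=
  congrFun (congrFun (show star (X : Matrix (Fin n) (Fin n) ℂ) = X from X.2) b) a

theorem HermitianMatrices.isHermitian {n : ℕ} (X : HermitianMatrices n) :
    (X : Matrix (Fin n) (Fin n) ℂ).IsHermitian := X.2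

/-- The Hermitian matrices whose diagonal blocks, with respect to the partition of the indices
into the fibres of `f`, are scalar. -/
def scalarBlocks {n : ℕ} {ι : Type*} (f : Fin n → ι) : Submodule ℝ (HermitianMatrices n) where
  carrier := {X | ∀ a b, f a = f b →
    (a ≠ b → (X : Matrix (Fin n) (Fin n) ℂ) a b = 0) ∧
      (X : Matrix (Fin n) (Fin n) ℂ) a a = (X : Matrix (Fin n) (Fin n) ℂ) b b}
  zero_mem' := by simp
  add_mem' := fun {X Y} hX hY a b h => by
    refine ⟨fun hab => ?_, ?_⟩
    · simp [(hX a b h).1 hab, (hY a b h).1 hab]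
    · simp [(hX a b h).2, (hY a b h).2]
  smul_mem' := fun r X hX a b h => by
    refine ⟨fun hab => ?_, ?_⟩
    · simp [(hX a b h).1 hab]
    · simp [(hX a b h).2]

/-- Real coordinates on the Hermitian matrices with scalar diagonal blocks. -/
noncomputable def scalarBlocksCoordinates {n : ℕ} {ι : Type*} (f : Fin n → ι) (s : ι → Fin n) :
    scalarBlocks f →ₗ[ℝ] ({p : Fin n × Fin n // f p.1 ≠ f p.2} ⊕ ι → ℝ) where
  toFun X := Sum.elim
    -- One real number per ordered pair: real parts are stored above the diagonal, imaginary parts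
    -- below it.
    (fun p => if p.1.1 < p.1.2 then (X.1.1 p.1.1 p.1.2).re else (X.1.1 p.1.1 p.1.2).im)
    (fun i => (X.1.1 (s i) (s i)).re)
  map_add' X Y := by
    ext (p | i)
    · by_cases h : p.1.1 < p.1.2 <;> simp [h]
    · simp
  map_smul' r X := by
    ext (p | i)
    · by_cases h : p.1.1 < p.1.2 <;> simp [h]
    · simp

theorem scalarBlocksCoordinates_bijective {n : ℕ} {ι : Type*} (f : Fin n → ι) (s : ι → Fin n)
    (hs : ∀ i, f (s i) = i) : Function.Bijective (scalarBlocksCoordinates f s) := by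
  classical
  constructor
  · refine (injective_iff_map_eq_zero _).2 fun X hX => ?_
    have hoff : ∀ a b, f a ≠ f b → a < b → X.1.1 a b = 0 := by
      intro a b hab hlt
      have h1 := congrFun hX (Sum.inl ⟨(a, b), hab⟩)
      have h2 := congrFun hX (Sum.inl ⟨(b, a), hab.symm⟩)
      simp only [scalarBlocksCoordinates, LinearMap.coe_mk, AddHom.coe_mk, Sum.elim_inl, hlt,
        hlt.not_gt, if_true, if_false, Pi.zero_apply] at h1 h2
      rw [← HermitianMatrices.star_apply] at h2
      apply Complex.ext
      · simpa using h1
      · simpa using h2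
    ext a b : 3
    by_cases hab : f a = f b
    · by_cases h : a = b
      · subst h
        have h1 := congrFun hX (Sum.inr (f a))
        simp only [scalarBlocksCoordinates, LinearMap.coe_mk, AddHom.coe_mk, Sum.elim_inr,
          Pi.zero_apply] at h1
        rw [(X.2 (s (f a)) a (hs _)).2] at h1
        apply Complex.ext
        · simpa using h1
        · have := congrArg Complex.im (HermitianMatrices.star_apply X.1 a a)
          simp only [RCLike.star_def, Complex.conj_im] at this
          change (X.1.1 a a).im = 0
          linarith
      · exact (X.2 a b hab).1 h
    · rcases lt_trichotomy a b with h | h | h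
      · exact hoff a b hab h
      · exact absurd (congrArg f h) hab
      · have := HermitianMatrices.star_apply X.1 b a
        rw [hoff b a (Ne.symm hab) h, star_zero] at this
        exact this.symm
  · intro g
    let G : Fin n → Fin n → ℝ := fun a b => if h : f a ≠ f b then g (Sum.inl ⟨(a, b), h⟩) else 0
    have hG : ∀ a b (h : f a ≠ f b), G a b = g (Sum.inl ⟨(a, b), h⟩) := fun a b h => dif_pos h
    let M : Matrix (Fin n) (Fin n) ℂ := fun a b =>
      if f a = f b then (if a = b then (g (Sum.inr (f a)) : ℂ) else 0)
      -- The sign undoes the conjugation: the stored imaginary part `G b a` belongs to the entry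
      -- below the diagonal.
      else if a < b then ⟨G a b, - G b a⟩ else ⟨G b a, G a b⟩
    have hM : star M = M := by
      ext a b
      change star (M b a) = M a b
      by_cases hab : f a = f b
      · by_cases h : a = b
        · subst h; simp [M]
        · simp [M, hab, h, Ne.symm h]
      · have hne : a ≠ b := fun h => hab (congrArg f h)
        rcases lt_or_gt_of_ne hne with h | h
        · simp only [M, hab, Ne.symm hab, h, h.not_gt, if_true, if_false]
          apply Complex.ext <;> simp
        · simp only [M, hab, Ne.symm hab, h, h.not_gt, if_true, if_false]
          apply Complex.ext <;> simp
    refine ⟨⟨⟨M, hM⟩, fun a b hab => ⟨fun h => ?_, ?_⟩⟩, ?_⟩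
    · simp [M, hab, h]
    · simp [M, hab]
    · ext (⟨⟨a, b⟩, hab⟩ | i)
      · have hab' : f a ≠ f b := hab
        by_cases h : a < b
        · simp [scalarBlocksCoordinates, M, h, hab', hG a b hab']
        · simp [scalarBlocksCoordinates, M, h, hab', hG a b hab']
      · simp [scalarBlocksCoordinates, M, hs]

/-- The coordinates are the ordered pairs in different fibres plus one per fibre, while the squared
fibre sizes count the pairs in equal fibres. The additive form avoids truncated subtraction. -/
theorem finrank_scalarBlocks {n : ℕ} {ι : Type*} [Fintype ι] [DecidableEq ι] (f : Fin n → ι)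
    (hf : Function.Surjective f) :
    finrank ℝ (scalarBlocks f) + ∑ i, Fintype.card {a // f a = i} ^ 2 =
      n ^ 2 + Fintype.card ι := by
  have hdim : finrank ℝ (scalarBlocks f) =
      Fintype.card {p : Fin n × Fin n // f p.1 ≠ f p.2} + Fintype.card ι := by
    rw [(LinearEquiv.ofBijective _ (scalarBlocksCoordinates_bijective f (Function.surjInv hf)
      (Function.surjInv_eq hf))).finrank_eq, finrank_pi, Fintype.card_sum]
  have h1 : ∑ i, Fintype.card {a // f a = i} ^ 2 =
      Fintype.card {p : Fin n × Fin n // f p.1 = f p.2} := by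
    simp_rw [pow_two, ← Fintype.card_prod]
    rw [← Fintype.card_sigma]
    refine Fintype.card_congr
      { toFun := fun x => ⟨(x.2.1, x.2.2), x.2.1.2.trans x.2.2.2.symm⟩
        invFun := fun p => ⟨f p.1.2, ⟨p.1.1, p.2⟩, ⟨p.1.2, rfl⟩⟩
        left_inv := ?_
        right_inv := fun p => rfl }
    rintro ⟨i, ⟨a, ha⟩, ⟨b, rfl⟩⟩
    rfl
  have h2 : Fintype.card {p : Fin n × Fin n // f p.1 = f p.2} +
      Fintype.card {p : Fin n × Fin n // f p.1 ≠ f p.2} = n ^ 2 := by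
    have := Fintype.card_subtype_compl (fun p : Fin n × Fin n => f p.1 = f p.2)
    have hle := Fintype.card_subtype_le (fun p : Fin n × Fin n => f p.1 = f p.2)
    rw [Fintype.card_prod, Fintype.card_fin] at this hle
    change _ + Fintype.card {p : Fin n × Fin n // ¬ f p.1 = f p.2} = _
    rw [pow_two]
    omega
  omega

theorem finrank_hermitianMatrices (n : ℕ) : finrank ℝ (HermitianMatrices n) = n ^ 2 := by
  -- Blocks of size one impose no condition.
  have h : scalarBlocks (id : Fin n → Fin n) = ⊤ := by
    rw [eq_top_iff]
    intro X _ a b hab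
    obtain rfl : a = b := hab
    simp
  have := finrank_scalarBlocks (id : Fin n → Fin n) Function.surjective_id
  rw [h, finrank_top] at this
  simpa using this

/-! ### The local diffeomorphism given by block conjugation. -/

/-- Leibniz rule at a point where the outer factors equal 1, as for exp(K) at K = 0. -/
theorem HasFDerivAt.mul_mul_star {E A : Type*} [NormedAddCommGroup E] [NormedSpace ℝ E]
    [NormedRing A] [NormedAlgebra ℝ A] [StarRing A] [StarModule ℝ A] [ContinuousStar A]
    {g B : E → A} {g' B' L : E →L[ℝ] A} {x : E} (hg : HasFDerivAt g g' x)
    (hB : HasFDerivAt B B' x) (h1 : g x = 1)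
    (hL : ∀ y, g' y * B x + B' y + B x * star (g' y) = L y) :
    HasFDerivAt (fun y => g y * B y * star (g y)) L x := by
  have hs := (starL' ℝ (A := A)).hasFDerivAt.comp x hg
  refine ((hg.mul' hB).mul' hs).congr_fderiv ?_
  ext1 y
  rw [← hL]
  simp [h1]
  abel

section BlockConjugation

-- The Frobenius norm is submultiplicative, so the norm already in use makes the matrices a normed
-- algebra, as the calculus of the exponential requires.
attribute [local instance] Matrix.frobeniusNormedRing Matrix.frobeniusNormedAlgebra

variable {n : ℕ} {ι : Type*} [DecidableEq ι]

/-- The part of a Hermitian matrix inside the diagonal blocks given by the fibres of `f`. -/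
def blockDiagonalPart (f : Fin n → ι) :
    HermitianMatrices n →ₗ[ℝ] Matrix (Fin n) (Fin n) ℂ where
  toFun X := Matrix.of fun a b => if f a = f b then X.1 a b else 0
  map_add' X Y := by
    ext a b
    by_cases h : f a = f b <;> simp [h]
  map_smul' r X := by
    ext a b
    by_cases h : f a = f b <;> simp [h]

/-- The skew-Hermitian matrix whose commutator with the diagonal matrix with entries `l (f a)` is
the part of a given Hermitian matrix outside the diagonal blocks. -/
noncomputable def offDiagonalGenerator (f : Fin n → ι) (l : ι → ℝ) :
    HermitianMatrices n →ₗ[ℝ] Matrix (Fin n) (Fin n) ℂ where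
  toFun X := Matrix.of fun a b => if f a = f b then 0 else X.1 a b / (l (f b) - l (f a) : ℝ)
  map_add' X Y := by
    ext a b
    by_cases h : f a = f b <;> simp [h, add_div]
  map_smul' r X := by
    ext a b
    by_cases h : f a = f b <;> simp [h, mul_div_assoc]

theorem star_blockDiagonalPart (f : Fin n → ι) (X : HermitianMatrices n) :
    star (blockDiagonalPart f X) = blockDiagonalPart f X := by
  ext a b
  change star (blockDiagonalPart f X b a) = _
  by_cases h : f a = f b
  · simpa [blockDiagonalPart, h] using HermitianMatrices.star_apply X b a
  · simp [blockDiagonalPart, h, Ne.symm h]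

theorem star_offDiagonalGenerator (f : Fin n → ι) (l : ι → ℝ) (X : HermitianMatrices n) :
    star (offDiagonalGenerator f l X) = -offDiagonalGenerator f l X := by
  ext a b
  change star (offDiagonalGenerator f l X b a) = -offDiagonalGenerator f l X a b
  by_cases h : f a = f b
  · simp [offDiagonalGenerator, h]
  · have := HermitianMatrices.star_apply X b a
    simp only [offDiagonalGenerator, LinearMap.coe_mk, AddHom.coe_mk, Matrix.of_apply, h,
      Ne.symm h, if_false, star_div₀, this]
    rw [← div_neg]
    congr 1
    simp

/-- The projection of the complex matrices onto the Hermitian ones. -/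
noncomputable def hermitianPart (n : ℕ) : Matrix (Fin n) (Fin n) ℂ →ₗ[ℝ] HermitianMatrices n :=
  (selfAdjointPart ℝ : Matrix (Fin n) (Fin n) ℂ →ₗ[ℝ] selfAdjoint (Matrix (Fin n) (Fin n) ℂ))

theorem coe_hermitianPart {M : Matrix (Fin n) (Fin n) ℂ} (hM : star M = M) :
    (hermitianPart n M : Matrix (Fin n) (Fin n) ℂ) = M :=
  IsSelfAdjoint.coe_selfAdjointPart_apply ℝ hM

/-- The block diagonal part of `X`, conjugated by the unitary generated by the remaining entries
of `X` and then by `U`. -/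
noncomputable def blockConjugation (U : Matrix (Fin n) (Fin n) ℂ) (f : Fin n → ι) (l : ι → ℝ)
    (X : HermitianMatrices n) : HermitianMatrices n :=
  -- The argument is already Hermitian; the linear projection only lands it in the subspace and
  -- keeps smoothness evident.
  hermitianPart n (U * (NormedSpace.exp (offDiagonalGenerator f l X) * blockDiagonalPart f X *
    star (NormedSpace.exp (offDiagonalGenerator f l X))) * star U)

theorem coe_blockConjugation (U : Matrix (Fin n) (Fin n) ℂ) (f : Fin n → ι) (l : ι → ℝ)
    (X : HermitianMatrices n) : (blockConjugation U f l X : Matrix (Fin n) (Fin n) ℂ) =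
      U * (NormedSpace.exp (offDiagonalGenerator f l X) * blockDiagonalPart f X *
        star (NormedSpace.exp (offDiagonalGenerator f l X))) * star U :=
  coe_hermitianPart (by simp only [star_mul, star_star, star_blockDiagonalPart, mul_assoc])

theorem charpoly_unitary_conj {U : Matrix (Fin n) (Fin n) ℂ} (hU : star U * U = 1)
    (M : Matrix (Fin n) (Fin n) ℂ) : (U * M * star U).charpoly = M.charpoly := by
  rw [Matrix.charpoly_mul_comm, ← mul_assoc, hU, one_mul]

/-- The exponential of a skew-Hermitian matrix is unitary, so both conjugations preserve the
characteristic polynomial. -/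
theorem charpoly_blockConjugation {U : Matrix (Fin n) (Fin n) ℂ} (hU : star U * U = 1)
    (f : Fin n → ι) (l : ι → ℝ) (X : HermitianMatrices n) :
    (blockConjugation U f l X : Matrix (Fin n) (Fin n) ℂ).charpoly =
      (blockDiagonalPart f X).charpoly := by
  have hK : offDiagonalGenerator f l X ∈ skewAdjoint (Matrix (Fin n) (Fin n) ℂ) :=
    star_offDiagonalGenerator f l X
  have hV := (Unitary.mem_iff.1 (NormedSpace.exp_mem_unitary_of_mem_skewAdjoint hK)).1
  rw [coe_blockConjugation, charpoly_unitary_conj hU]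
  exact charpoly_unitary_conj hV _

theorem contDiff_blockConjugation (U : Matrix (Fin n) (Fin n) ℂ) (f : Fin n → ι) (l : ι → ℝ) :
    ContDiff ℝ ∞ (blockConjugation U f l) := by
  have hexp : ContDiff ℝ ∞ (NormedSpace.exp : Matrix (Fin n) (Fin n) ℂ → _) :=
    contDiff_iff_contDiffAt.2 fun x => (NormedSpace.exp_analytic (𝕂 := ℝ) x).contDiffAt
  have hK : ContDiff ℝ ∞ (offDiagonalGenerator f l) :=
    (offDiagonalGenerator f l).toContinuousLinearMap.contDiff
  have hB : ContDiff ℝ ∞ (blockDiagonalPart f) :=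
    (blockDiagonalPart f).toContinuousLinearMap.contDiff
  have hs : ContDiff ℝ ∞ (star : Matrix (Fin n) (Fin n) ℂ → _) :=
    (starL' ℝ (A := Matrix (Fin n) (Fin n) ℂ)).contDiff
  exact (hermitianPart n).toContinuousLinearMap.contDiff.comp
    ((contDiff_const.mul (((hexp.comp hK).mul hB).mul (hs.comp (hexp.comp hK)))).mul
      contDiff_const)

theorem offDiagonalGenerator_diagonal (f : Fin n → ι) (l : ι → ℝ) {D : HermitianMatrices n}
    (hD : (D : Matrix (Fin n) (Fin n) ℂ) = Matrix.diagonal fun a => (l (f a) : ℂ)) :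
    offDiagonalGenerator f l D = 0 := by
  ext a b
  by_cases h : f a = f b
  · simp [offDiagonalGenerator, h]
  · have hne : a ≠ b := fun hab => h (congrArg f hab)
    simp [offDiagonalGenerator, h, hD, hne]

theorem blockDiagonalPart_diagonal (f : Fin n → ι) (l : ι → ℝ) {D : HermitianMatrices n}
    (hD : (D : Matrix (Fin n) (Fin n) ℂ) = Matrix.diagonal fun a => (l (f a) : ℂ)) :
    blockDiagonalPart f D = Matrix.diagonal fun a => (l (f a) : ℂ) := by
  ext a b
  by_cases h : f a = f b
  · simp [blockDiagonalPart, h, hD]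
  · have hne : a ≠ b := fun hab => h (congrArg f hab)
    simp [blockDiagonalPart, h, hne]

theorem coe_blockConjugation_diagonal (U : Matrix (Fin n) (Fin n) ℂ) (f : Fin n → ι) (l : ι → ℝ)
    {D : HermitianMatrices n}
    (hD : (D : Matrix (Fin n) (Fin n) ℂ) = Matrix.diagonal fun a => (l (f a) : ℂ)) :
    (blockConjugation U f l D : Matrix (Fin n) (Fin n) ℂ) =
      U * (Matrix.diagonal fun a => (l (f a) : ℂ)) * star U := by
  rw [coe_blockConjugation, offDiagonalGenerator_diagonal f l hD,
    blockDiagonalPart_diagonal f l hD]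
  simp

/-- The denominators in the generator are chosen to cancel the factor l (f b) - l (f a) produced by
the commutator with the diagonal matrix. -/
theorem commutator_offDiagonalGenerator_add_blockDiagonalPart (f : Fin n → ι) {l : ι → ℝ}
    (hl : Function.Injective l) (H : HermitianMatrices n) :
    offDiagonalGenerator f l H * (Matrix.diagonal fun a => (l (f a) : ℂ)) +
      blockDiagonalPart f H +
      (Matrix.diagonal fun a => (l (f a) : ℂ)) * star (offDiagonalGenerator f l H) = H := by
  rw [star_offDiagonalGenerator, mul_neg]
  ext a b
  simp only [Matrix.add_apply, Matrix.neg_apply, Matrix.mul_diagonal, Matrix.diagonal_mul]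
  by_cases h : f a = f b
  · simp [offDiagonalGenerator, blockDiagonalPart, h]
  · have : (l (f b) : ℂ) - l (f a) ≠ 0 := by
      rw [sub_ne_zero]
      exact fun hab => h (hl (Complex.ofReal_injective hab)).symm
    simp only [offDiagonalGenerator, blockDiagonalPart, h, LinearMap.coe_mk, AddHom.coe_mk,
      Matrix.of_apply, if_false, Complex.ofReal_sub]
    field_simp
    ring

/-- Conjugation by a unitary matrix is injective on the Hermitian matrices. -/
theorem injective_hermitianPart_conj {U : Matrix (Fin n) (Fin n) ℂ} (hU : star U * U = 1) :
    Function.Injective fun H : HermitianMatrices n =>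
      hermitianPart n (U * (H : Matrix (Fin n) (Fin n) ℂ) * star U) := by
  intro H H' h
  have hH : ∀ H : HermitianMatrices n,
      star (U * (H : Matrix (Fin n) (Fin n) ℂ) * star U) = U * H * star U := fun H => by
    rw [star_mul, star_mul, star_star, show star (H : Matrix (Fin n) (Fin n) ℂ) = H from H.2,
      mul_assoc]
  have h1 := congrArg (Subtype.val) h
  simp only [coe_hermitianPart (hH _)] at h1
  have h2 := congrArg (fun M => star U * M * U) h1
  simp only [mul_assoc, hU, mul_one] at h2
  simp only [← mul_assoc, hU, one_mul] at h2
  exact Subtype.ext h2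

theorem hasFDerivAt_blockConjugation {U : Matrix (Fin n) (Fin n) ℂ} (hU : star U * U = 1)
    (f : Fin n → ι) {l : ι → ℝ} (hl : Function.Injective l) {D : HermitianMatrices n}
    (hD : (D : Matrix (Fin n) (Fin n) ℂ) = Matrix.diagonal fun a => (l (f a) : ℂ)) :
    ∃ e : HermitianMatrices n ≃L[ℝ] HermitianMatrices n,
      HasFDerivAt (blockConjugation U f l) (e : HermitianMatrices n →L[ℝ] HermitianMatrices n)
        D := by
  have hKD := offDiagonalGenerator_diagonal f l hD
  have hBD := blockDiagonalPart_diagonal f l hD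
  have hcomm := commutator_offDiagonalGenerator_add_blockDiagonalPart f hl
  let C : HermitianMatrices n →ₗ[ℝ] HermitianMatrices n :=
    hermitianPart n ∘ₗ LinearMap.mulRight ℝ (star U) ∘ₗ LinearMap.mulLeft ℝ U ∘ₗ
      (HermitianMatrices n).subtype
  have hC : Function.Injective C := injective_hermitianPart_conj hU
  let e := (LinearEquiv.ofInjectiveEndo C hC).toContinuousLinearEquiv
  refine ⟨e, ?_⟩
  have hexp : HasFDerivAt (fun X => NormedSpace.exp (offDiagonalGenerator f l X))
      (offDiagonalGenerator f l).toContinuousLinearMap D := by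
    have h := hasFDerivAt_exp_zero (𝕂 := ℝ) (𝔸 := Matrix (Fin n) (Fin n) ℂ)
    rw [← hKD] at h
    exact h.comp D (offDiagonalGenerator f l).toContinuousLinearMap.hasFDerivAt
  have hB : HasFDerivAt (blockDiagonalPart f) (blockDiagonalPart f).toContinuousLinearMap D :=
    (blockDiagonalPart f).toContinuousLinearMap.hasFDerivAt
  have hconj : HasFDerivAt (fun X => NormedSpace.exp (offDiagonalGenerator f l X) *
      blockDiagonalPart f X * star (NormedSpace.exp (offDiagonalGenerator f l X)))
      (HermitianMatrices n).subtype.toContinuousLinearMap D := by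
    refine hexp.mul_mul_star hB ?_ fun H => ?_
    · rw [hKD, NormedSpace.exp_zero]
    · rw [hBD]
      exact hcomm H
  have houter : HasFDerivAt (fun M : Matrix (Fin n) (Fin n) ℂ => hermitianPart n (U * M * star U))
      (hermitianPart n ∘ₗ LinearMap.mulRight ℝ (star U) ∘ₗ
        LinearMap.mulLeft ℝ U).toContinuousLinearMap
      (NormedSpace.exp (offDiagonalGenerator f l D) *
        blockDiagonalPart f D * star (NormedSpace.exp (offDiagonalGenerator f l D))) :=
    (hermitianPart n ∘ₗ LinearMap.mulRight ℝ (star U) ∘ₗ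
        LinearMap.mulLeft ℝ U).toContinuousLinearMap.hasFDerivAt
  exact houter.comp D hconj

end BlockConjugation

/-! ### Eigenvalues of block-diagonal matrices near a diagonal one. -/

theorem Polynomial.rootMultiplicity_prod_X_sub_C_pow {ι : Type*} [Fintype ι] {μ : ι → ℂ}
    (hμ : Function.Injective μ) (k : ι → ℕ) (j : ι) :
    (∏ i, (Polynomial.X - Polynomial.C (μ i)) ^ k i).rootMultiplicity (μ j) = k j := by
  classical
  have hne : (∏ i, (Polynomial.X - Polynomial.C (μ i)) ^ k i) ≠ 0 :=
    Finset.prod_ne_zero_iff.2 fun i _ => pow_ne_zero _ (Polynomial.X_sub_C_ne_zero _)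
  rw [← Polynomial.count_roots, Polynomial.roots_prod _ _ hne]
  simp [Multiset.count_bind, Multiset.count_singleton, hμ.eq_iff]

theorem Polynomial.isRoot_prod_X_sub_C_pow {ι : Type*} [Fintype ι] {μ : ι → ℂ} {k : ι → ℕ}
    {z : ℂ} (h : (∏ i, (Polynomial.X - Polynomial.C (μ i)) ^ k i).IsRoot z) : ∃ i, z = μ i := by
  rw [Polynomial.IsRoot.def, Polynomial.eval_prod, Finset.prod_eq_zero_iff] at h
  obtain ⟨i, -, hi⟩ := h
  rw [Polynomial.eval_pow] at hi
  have := eq_zero_of_pow_eq_zero hi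
  exact ⟨i, by simpa [sub_eq_zero] using this⟩

theorem Matrix.exists_norm_sub_le_of_isRoot_charpoly {m : Type*} [Fintype m] [DecidableEq m]
    {M : Matrix m m ℂ} {z : ℂ} (hz : M.charpoly.IsRoot z) :
    ∃ a, ‖z - M a a‖ ≤ ∑ b ∈ Finset.univ.erase a, ‖M a b‖ := by
  have : Module.End.HasEigenvalue (Matrix.toLin' M) z := by
    rw [Module.End.hasEigenvalue_iff_isRoot_charpoly]
    simpa using hz
  obtain ⟨a, ha⟩ := eigenvalue_mem_ball this
  exact ⟨a, by simpa [dist_eq_norm] using ha⟩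

/-- Diagonalizability turns a single eigenvalue into a scalar matrix; this is where Hermitian
symmetry of the blocks enters. -/
theorem Matrix.IsHermitian.eq_smul_one_of_isRoot {m : Type*} [Fintype m] [DecidableEq m]
    {M : Matrix m m ℂ} (hM : M.IsHermitian) {ν : ℂ} (h : ∀ z, M.charpoly.IsRoot z → z = ν) :
    M = ν • (1 : Matrix m m ℂ) := by
  have hd : Matrix.diagonal (RCLike.ofReal ∘ hM.eigenvalues) = ν • (1 : Matrix m m ℂ) := by
    ext a b
    by_cases hab : a = b
    · subst hab
      have : (hM.eigenvalues a : ℂ) = ν := by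
        apply h
        rw [hM.charpoly_eq, Polynomial.IsRoot.def, Polynomial.eval_prod]
        exact Finset.prod_eq_zero (Finset.mem_univ a) (by simp)
      simpa using this
    · simp [hab]
  rw [hM.spectral_theorem, hd, map_smul, map_one]

theorem Matrix.charpoly_diagonal_comp {n I : ℕ} {f : Fin n → Fin I} {k : Fin I → ℕ}
    (hk : ∀ i, Fintype.card {a // f a = i} = k i) (c : Fin I → ℂ) :
    (Matrix.diagonal fun a => c (f a)).charpoly =
      ∏ i, (Polynomial.X - Polynomial.C (c i)) ^ k i := by
  rw [Matrix.charpoly_diagonal]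
  rw [← Finset.prod_fiberwise_of_maps_to' (s := Finset.univ) (t := Finset.univ) (g := f) (by simp)
    (fun i => Polynomial.X - Polynomial.C (c i))]
  refine Finset.prod_congr rfl fun i _ => ?_
  rw [Finset.prod_const, ← hk, Fintype.card_subtype]

section BlockEigenvalues

variable {n I : ℕ} {f : Fin n → Fin I} {k : Fin I → ℕ} {l : Fin I → ℝ} {δ : ℝ}
  {X : HermitianMatrices n}

theorem blockTriangular_blockDiagonalPart (f : Fin n → Fin I) (X : HermitianMatrices n) :
    (blockDiagonalPart f X).BlockTriangular f := fun a b h => by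
  simp [blockDiagonalPart, h.ne']

theorem charpoly_blockDiagonalPart (hf : Function.Surjective f) (X : HermitianMatrices n) :
    (blockDiagonalPart f X).charpoly =
      ∏ i, ((blockDiagonalPart f X).toSquareBlock f i).charpoly := by
  rw [(blockTriangular_blockDiagonalPart f X).charpoly, Finset.image_univ_of_surjective hf]

/-- The scalars of the blocks stay within δ of the l i, hence remain distinct, and each is repeated
as often as its fibre is large. -/
theorem hasEigenvalueMultiplicities_of_mem_scalarBlocks
    (hk : ∀ i, Fintype.card {a // f a = i} = k i)
    (hf : Function.Surjective f) (hl : ∀ i j, i ≠ j → 2 * δ ≤ |l i - l j|)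
    (hX : ∀ a, ‖blockDiagonalPart f X a a - l (f a)‖ +
      ∑ b ∈ Finset.univ.erase a, ‖blockDiagonalPart f X a b‖ < δ)
    (h : X ∈ scalarBlocks f) : HasEigenvalueMultiplicities (blockDiagonalPart f X) k := by
  let s := Function.surjInv hf
  have hs : ∀ i, f (s i) = i := Function.surjInv_eq hf
  have hd : ∀ i, ‖X.1 (s i) (s i) - l i‖ < δ := fun i => by
    have h1 := hX (s i)
    have h2 : 0 ≤ ∑ b ∈ Finset.univ.erase (s i), ‖blockDiagonalPart f X (s i) b‖ :=
      Finset.sum_nonneg fun _ _ => norm_nonneg _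
    have h3 : blockDiagonalPart f X (s i) (s i) = X.1 (s i) (s i) := by simp [blockDiagonalPart]
    rw [h3, hs] at h1
    linarith
  refine ⟨fun i => X.1 (s i) (s i), fun i j hij => ?_, ?_⟩
  · by_contra hne
    have h1 : ‖(l i : ℂ) - l j‖ < 2 * δ := by
      have e : (l i : ℂ) - l j = (X.1 (s j) (s j) - l j) - (X.1 (s i) (s i) - l i) := by
        rw [show X.1 (s i) (s i) = X.1 (s j) (s j) from hij]; ring
      rw [e]
      have := norm_sub_le (X.1 (s j) (s j) - l j) (X.1 (s i) (s i) - l i)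
      have := hd i
      have := hd j
      linarith
    rw [← Complex.ofReal_sub, Complex.norm_real, Real.norm_eq_abs] at h1
    exact (hl i j hne).not_gt h1
  · rw [← Matrix.charpoly_diagonal_comp hk]
    congr 1
    ext a b
    by_cases hab : f a = f b
    · by_cases hne : a = b
      · subst hne
        simp [blockDiagonalPart, (h a (s (f a)) (hs _).symm).2]
      · simp [blockDiagonalPart, hne, (h a b hab).1 hne]
    · have hne : a ≠ b := fun e => hab (congrArg f e)
      simp [blockDiagonalPart, hab, hne]

/-- Pigeonhole: by Gershgorin the I blocks have nonempty, pairwise disjoint root sets inside a set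
of I eigenvalues, so each block has exactly one root. -/
theorem mem_scalarBlocks_of_hasEigenvalueMultiplicities
    (hf : Function.Surjective f) (hl : ∀ i j, i ≠ j → 2 * δ ≤ |l i - l j|)
    (hX : ∀ a, ‖blockDiagonalPart f X a a - l (f a)‖ +
      ∑ b ∈ Finset.univ.erase a, ‖blockDiagonalPart f X a b‖ < δ)
    (h : HasEigenvalueMultiplicities (blockDiagonalPart f X) k) : X ∈ scalarBlocks f := by
  obtain ⟨μ, hμ, hchar⟩ := h
  have hroot : ∀ i z, ((blockDiagonalPart f X).toSquareBlock f i).charpoly.IsRoot z →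
      ‖z - l i‖ < δ := by
    intro i z hz
    obtain ⟨⟨a, rfl⟩, ha⟩ := Matrix.exists_norm_sub_le_of_isRoot_charpoly hz
    have h1 : ∑ b ∈ Finset.univ.erase (⟨a, rfl⟩ : {b // f b = f a}),
        ‖(blockDiagonalPart f X).toSquareBlock f (f a) ⟨a, rfl⟩ b‖ ≤
        ∑ b ∈ Finset.univ.erase a, ‖blockDiagonalPart f X a b‖ := by
      refine (Finset.sum_map (Finset.univ.erase (⟨a, rfl⟩ : {b // f b = f a}))
        (Function.Embedding.subtype _) (fun b => ‖blockDiagonalPart f X a b‖)).ge.trans ?_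
      refine Finset.sum_le_sum_of_subset_of_nonneg ?_ fun _ _ _ => norm_nonneg _
      intro b hb
      obtain ⟨b, hb', rfl⟩ := Finset.mem_map.1 hb
      refine Finset.mem_erase.2 ⟨fun e => ?_, Finset.mem_univ _⟩
      exact (Finset.mem_erase.1 hb').1 (Subtype.ext (a1 := b) (a2 := ⟨a, rfl⟩) e)
    have h2 := norm_add_le (z - blockDiagonalPart f X a a) (blockDiagonalPart f X a a - l (f a))
    rw [sub_add_sub_cancel] at h2
    have h3 := hX a
    have h4 : ‖z - blockDiagonalPart f X a a‖ ≤ _ := ha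
    linarith
  have hex : ∀ i, ∃ z, ((blockDiagonalPart f X).toSquareBlock f i).charpoly.IsRoot z := by
    intro i
    have : Nonempty {a // f a = i} := let ⟨a, ha⟩ := hf i; ⟨⟨a, ha⟩⟩
    apply IsAlgClosed.exists_root
    rw [Matrix.charpoly_degree_eq_dim]
    exact_mod_cast Fintype.card_ne_zero
  choose ν hν using hex
  have hνμ : ∀ i z, ((blockDiagonalPart f X).toSquareBlock f i).charpoly.IsRoot z →
      ∃ j, z = μ j := by
    intro i z hz
    apply Polynomial.isRoot_prod_X_sub_C_pow (k := k)
    rw [← hchar, charpoly_blockDiagonalPart hf, Polynomial.IsRoot.def, Polynomial.eval_prod]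
    exact Finset.prod_eq_zero (Finset.mem_univ i) hz
  have hsep : ∀ (i j : Fin I) (z : ℂ), ‖z - l i‖ < δ → ‖z - l j‖ < δ → i = j := by
    intro i j z hi hj
    by_contra hne
    have h1 := norm_sub_le (z - l j) (z - l i)
    rw [sub_sub_sub_cancel_left, ← Complex.ofReal_sub, Complex.norm_real,
      Real.norm_eq_abs] at h1
    have := hl i j hne
    linarith
  -- σ sends a block to the index of one of its eigenvalues. Separation makes it injective, hence
  -- bijective, so any other root of block i would belong to another block.
  choose σ hσ using fun i => hνμ i (ν i) (hν i)
  have hσinj : Function.Injective σ := fun i j hij =>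
    hsep i j (ν i) (hroot _ _ (hν i)) (by
      rw [hσ i, hij, ← hσ j]; exact hroot _ _ (hν j))
  have hσsurj : Function.Surjective σ := Finite.surjective_of_injective hσinj
  have huniq : ∀ i z, ((blockDiagonalPart f X).toSquareBlock f i).charpoly.IsRoot z →
      z = ν i := by
    intro i z hz
    obtain ⟨j, hj⟩ := hνμ i z hz
    obtain ⟨i', rfl⟩ := hσsurj j
    rw [← hσ] at hj
    have : i = i' := hsep i i' z (hroot i z hz) (hj ▸ hroot _ _ (hν i'))
    rw [hj, this]
  have hherm : ∀ i, ((blockDiagonalPart f X).toSquareBlock f i).IsHermitian := fun i =>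
    Matrix.IsHermitian.submatrix (star_blockDiagonalPart f X) _
  have hblock : ∀ i, (blockDiagonalPart f X).toSquareBlock f i = ν i • 1 := fun i =>
    (hherm i).eq_smul_one_of_isRoot (huniq i)
  have hentry : ∀ a b (hab : f a = f b), X.1 a b = if a = b then ν (f b) else 0 := by
    intro a b hab
    have := congrFun (congrFun (hblock (f b)) ⟨a, hab⟩) ⟨b, rfl⟩
    have h2 : (blockDiagonalPart f X).toSquareBlock f (f b) ⟨a, hab⟩ ⟨b, rfl⟩ = X.1 a b := by
      simp [Matrix.toSquareBlock_def, blockDiagonalPart, hab]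
    rw [h2] at this
    rw [this]
    simp [Matrix.one_apply]
  intro a b hab
  refine ⟨fun hne => ?_, ?_⟩
  · rw [hentry a b hab, if_neg hne]
  · rw [hentry a a rfl, hentry b b rfl, if_pos rfl, if_pos rfl, hab]

theorem eventually_hasEigenvalueMultiplicities_iff {l : Fin I → ℝ} (hl : Function.Injective l)
    (hf : Function.Surjective f) (hk : ∀ i, Fintype.card {a // f a = i} = k i)
    {D : HermitianMatrices n}
    (hD : (D : Matrix (Fin n) (Fin n) ℂ) = Matrix.diagonal fun a => (l (f a) : ℂ)) :
    ∀ᶠ X in 𝓝 D, HasEigenvalueMultiplicities (blockDiagonalPart f X) k ↔ X ∈ scalarBlocks f := by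
  -- Any small enough δ works; a limit at 0 replaces the least gap, which would be a minimum over an
  -- empty set when I ≤ 1.
  obtain ⟨δ, hδ, hδl⟩ : ∃ δ : ℝ, 0 < δ ∧ ∀ i j, i ≠ j → 2 * δ ≤ |l i - l j| := by
    have : ∀ᶠ δ : ℝ in 𝓝[>] 0, ∀ i j, i ≠ j → 2 * δ ≤ |l i - l j| := by
      refine eventually_all.2 fun i => eventually_all.2 fun j => ?_
      by_cases hij : i = j
      · exact Eventually.of_forall fun _ h => absurd hij h
      · have hpos : 0 < |l i - l j| / 2 :=
          half_pos (abs_pos.2 (sub_ne_zero.2 (hl.ne hij)))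
        filter_upwards [nhdsWithin_le_nhds (Iio_mem_nhds hpos)] with δ hδ _
        have : δ < |l i - l j| / 2 := hδ
        linarith
    exact (eventually_mem_nhdsWithin.and this).exists
  have hcont : ∀ a b, Continuous fun X : HermitianMatrices n => blockDiagonalPart f X a b := by
    intro a b
    exact (continuous_apply_apply a b).comp
      (blockDiagonalPart f).toContinuousLinearMap.continuous
  have hnear : ∀ᶠ X in 𝓝 D, ∀ a, ‖blockDiagonalPart f X a a - l (f a)‖ +
      ∑ b ∈ Finset.univ.erase a, ‖blockDiagonalPart f X a b‖ < δ := by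
    refine eventually_all.2 fun a => ?_
    have hc : Continuous fun X : HermitianMatrices n => ‖blockDiagonalPart f X a a - l (f a)‖ +
        ∑ b ∈ Finset.univ.erase a, ‖blockDiagonalPart f X a b‖ := by
      refine ((hcont a a).sub continuous_const).norm.add ?_
      exact continuous_finsetSum _ fun b _ => (hcont a b).norm
    refine hc.continuousAt.eventually_lt continuousAt_const ?_
    rw [blockDiagonalPart_diagonal f l hD]
    have : ∑ b ∈ Finset.univ.erase a, ‖Matrix.diagonal (fun a => (l (f a) : ℂ)) a b‖ = 0 :=
      Finset.sum_eq_zero fun b hb => by simp [(Finset.ne_of_mem_erase hb).symm]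
    rw [this]
    simpa using hδ
  filter_upwards [hnear] with X hX
  exact ⟨mem_scalarBlocks_of_hasEigenvalueMultiplicities hf hδl hX,
    hasEigenvalueMultiplicities_of_mem_scalarBlocks hk hf hδl hX⟩

end BlockEigenvalues

/-! ### Strata with prescribed multiplicities. -/

/-- The real diagonal matrix with given entries, as a Hermitian matrix. -/
noncomputable def diagonalHermitian {n : ℕ} (d : Fin n → ℝ) : HermitianMatrices n :=
  ⟨Matrix.diagonal fun a => (d a : ℂ), by
    change star (Matrix.diagonal fun a => (d a : ℂ)) = _
    rw [Matrix.star_eq_conjTranspose, Matrix.diagonal_conjTranspose]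
    congr 1
    ext a
    simp⟩

theorem surjective_of_card_fiber {n I : ℕ} {f : Fin n → Fin I} {k : Fin I → ℕ}
    (hk : ∀ i, Fintype.card {a // f a = i} = k i) (hpos : ∀ i, 1 ≤ k i) :
    Function.Surjective f := fun i => by
  have : 0 < Fintype.card {a // f a = i} := (hk i).symm ▸ hpos i
  obtain ⟨a, ha⟩ := Fintype.card_pos_iff.1 this
  exact ⟨a, ha⟩

theorem exists_card_fiber_eq {n I : ℕ} {k : Fin I → ℕ} (hsum : ∑ i, k i = n) :
    ∃ f : Fin n → Fin I, ∀ i, Fintype.card {a // f a = i} = k i := by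
  let e : (Σ i, Fin (k i)) ≃ Fin n := finSigmaFinEquiv.trans (finCongr hsum)
  refine ⟨fun a => (e.symm a).1, fun i => ?_⟩
  have e' : {a // (e.symm a).1 = i} ≃ Fin (k i) :=
    (e.symm.subtypeEquiv fun _ => Iff.rfl).trans (Equiv.sigmaSubtype i)
  rw [Fintype.card_congr e', Fintype.card_fin]

theorem finrank_scalarBlocks_add_codim {n I : ℕ} {f : Fin n → Fin I} {k : Fin I → ℕ}
    (hk : ∀ i, Fintype.card {a // f a = i} = k i) (hpos : ∀ i, 1 ≤ k i) :
    finrank ℝ (scalarBlocks f) + ∑ i, (k i ^ 2 - 1) = n ^ 2 := by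
  have h1 := finrank_scalarBlocks f (surjective_of_card_fiber hk hpos)
  simp only [hk, Fintype.card_fin] at h1
  have h2 : ∑ i, k i ^ 2 = ∑ i, (k i ^ 2 - 1) + I := by
    have : ∀ i, k i ^ 2 = (k i ^ 2 - 1) + 1 := fun i =>
      (Nat.sub_add_cancel (Nat.one_le_pow _ _ (hpos i))).symm
    rw [Finset.sum_congr rfl fun i _ => this i, Finset.sum_add_distrib]
    simp
  omega

theorem exists_unitary_diagonalization {n I : ℕ} {k : Fin I → ℕ} (hpos : ∀ i, 1 ≤ k i)
    {A : HermitianMatrices n} (hA : A ∈ hermitianStratum n k) :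
    ∃ (U : Matrix (Fin n) (Fin n) ℂ) (f : Fin n → Fin I) (l : Fin I → ℝ),
      star U * U = 1 ∧ (∀ i, Fintype.card {a // f a = i} = k i) ∧ Function.Injective l ∧
      (A : Matrix (Fin n) (Fin n) ℂ) =
        U * (Matrix.diagonal fun a => (l (f a) : ℂ)) * star U := by
  obtain ⟨μ, hμ, hchar⟩ := hA
  have hH := HermitianMatrices.isHermitian A
  have hex : ∀ a, ∃ i, (hH.eigenvalues a : ℂ) = μ i := fun a => by
    apply Polynomial.isRoot_prod_X_sub_C_pow (k := k)
    rw [← hchar, hH.charpoly_eq, Polynomial.IsRoot.def, Polynomial.eval_prod]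
    exact Finset.prod_eq_zero (Finset.mem_univ a) (by simp)
  choose f hf using hex
  have hk : ∀ i, Fintype.card {a // f a = i} = k i := by
    intro i
    rw [← Polynomial.rootMultiplicity_prod_X_sub_C_pow hμ k i, ← hchar, hH.charpoly_eq]
    -- The eigenvalues grouped by `f` give a second factorization over the same μ; comparing root
    -- multiplicities identifies the fibre sizes.
    have h1 : (∏ a, (Polynomial.X - Polynomial.C (hH.eigenvalues a : ℂ))) =
        (Matrix.diagonal fun a => μ (f a)).charpoly := by
      rw [Matrix.charpoly_diagonal]
      exact Finset.prod_congr rfl fun a _ => by rw [hf]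
    have h2 := Polynomial.rootMultiplicity_prod_X_sub_C_pow hμ
      (fun i => Fintype.card {a // f a = i}) i
    rw [← Matrix.charpoly_diagonal_comp (f := f) (fun _ => rfl) μ, ← h1] at h2
    exact h2.symm
  have hsurj := surjective_of_card_fiber hk hpos
  -- Positive multiplicities make every μ i occur as an eigenvalue, and those are real.
  have hre : ∀ i, ((μ i).re : ℂ) = μ i := fun i => by
    obtain ⟨a, rfl⟩ := hsurj i
    rw [← hf, Complex.ofReal_re]
  refine ⟨hH.eigenvectorUnitary, f, fun i => (μ i).re, ?_, hk, fun i j hij => ?_, ?_⟩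
  · exact Unitary.coe_star_mul_self hH.eigenvectorUnitary
  · apply hμ
    rw [← hre i, ← hre j]
    exact congrArg _ hij
  · have := hH.spectral_theorem
    rw [Unitary.conjStarAlgAut_apply] at this
    refine this.trans ?_
    congr 3
    ext a
    simp only [Function.comp_apply, ← hf]
    rfl

theorem diagonalHermitian_mem_hermitianStratum {n I : ℕ} {f : Fin n → Fin I} {k : Fin I → ℕ}
    (hk : ∀ i, Fintype.card {a // f a = i} = k i) {l : Fin I → ℝ} (hl : Function.Injective l) :
    diagonalHermitian (fun a => l (f a)) ∈ hermitianStratum n k :=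
  ⟨fun i => (l i : ℂ), Complex.ofReal_injective.comp hl,
    Matrix.charpoly_diagonal_comp hk fun i => (l i : ℂ)⟩

theorem hermitianStratum_nonempty {n I : ℕ} {k : Fin I → ℕ} (hsum : ∑ i, k i = n) :
    (hermitianStratum n k).Nonempty := by
  -- The witness is diagonal with eigenvalues 0, …, I - 1.
  obtain ⟨f, hf⟩ := exists_card_fiber_eq hsum
  exact ⟨_, diagonalHermitian_mem_hermitianStratum hf
    (l := fun i => ((i : ℕ) : ℝ)) (Nat.cast_injective.comp Fin.val_injective)⟩

theorem sum_sq_sub_one_le {n I : ℕ} {k : Fin I → ℕ} (hpos : ∀ i, 1 ≤ k i)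
    (hsum : ∑ i, k i = n) : ∑ i, (k i ^ 2 - 1) ≤ n ^ 2 := by
  obtain ⟨f, hf⟩ := exists_card_fiber_eq hsum
  have := finrank_scalarBlocks_add_codim hf hpos
  omega

theorem isEmbeddedSubmanifold_hermitianStratum {n I : ℕ} {k : Fin I → ℕ} (hpos : ∀ i, 1 ≤ k i) :
    IsEmbeddedSubmanifold (hermitianStratum n k)
      (n ^ 2 - ∑ i, (k i ^ 2 - 1)) (∑ i, (k i ^ 2 - 1)) := by
  intro A hA
  obtain ⟨U, f, l, hU, hk, hl, hAU⟩ := exists_unitary_diagonalization hpos hA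
  let D := diagonalHermitian fun a => l (f a)
  have hD : (D : Matrix (Fin n) (Fin n) ℂ) = Matrix.diagonal fun a => (l (f a) : ℂ) := rfl
  obtain ⟨e, he⟩ := hasFDerivAt_blockConjugation hU f hl hD
  have hdim := finrank_scalarBlocks_add_codim hk hpos
  have hDA : blockConjugation U f l D = A :=
    Subtype.ext ((coe_blockConjugation_diagonal U f l hD).trans hAU.symm)
  rw [← hDA]
  refine exists_submanifold_chart (contDiff_blockConjugation U f l) he (W := scalarBlocks f)
    (by omega) (by rw [finrank_hermitianMatrices]; omega) ?_
  filter_upwards [eventually_hasEigenvalueMultiplicities_iff hl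
    (surjective_of_card_fiber hk hpos) hk hD] with X hX
  rw [← hX]
  simp only [hermitianStratum, Set.mem_ofPred_eq, HasEigenvalueMultiplicities,
    charpoly_blockConjugation hU]

theorem dimH_hermitianStratum {n I : ℕ} {k : Fin I → ℕ} (hpos : ∀ i, 1 ≤ k i)
    (hsum : ∑ i, k i = n) :
    dimH (hermitianStratum n k) = ((n ^ 2 - ∑ i, (k i ^ 2 - 1) : ℕ) : ENNReal) :=
  (isEmbeddedSubmanifold_hermitianStratum hpos).dimH_eq (hermitianStratum_nonempty hsum)

/-! ### Matrices with a k-fold eigenvalue. -/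

theorem one_le_cons {k N : ℕ} (hk : 1 ≤ k) (i : Fin (N + 1)) :
    1 ≤ (Fin.cons k (fun _ => 1) : Fin (N + 1) → ℕ) i := by
  cases i using Fin.cases <;> simp [hk]

theorem sum_cons_one {n k : ℕ} (hkn : k ≤ n) :
    ∑ i, (Fin.cons k (fun _ => 1) : Fin (n - k + 1) → ℕ) i = n := by
  rw [Fin.sum_univ_succ]
  simp only [Fin.cons_zero, Fin.cons_succ, Finset.sum_const, Finset.card_univ, Fintype.card_fin,
    smul_eq_mul, mul_one]
  omega

theorem sum_cons_sq_sub_one (k N : ℕ) :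
    ∑ i, ((Fin.cons k (fun _ => 1) : Fin (N + 1) → ℕ) i ^ 2 - 1) = k ^ 2 - 1 := by
  simp [Fin.sum_univ_succ]

theorem sq_sub_one_le_sum {I k : ℕ} {m : Fin I → ℕ} (h : ∃ i, m i = k) :
    k ^ 2 - 1 ≤ ∑ i, (m i ^ 2 - 1) := by
  obtain ⟨i, rfl⟩ := h
  exact Finset.single_le_sum (f := fun i => m i ^ 2 - 1) (fun _ _ => Nat.zero_le _)
    (Finset.mem_univ i)

theorem exists_mem_hermitianStratum {n k : ℕ} (hk : 1 ≤ k) {A : HermitianMatrices n}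
    (hA : A ∈ hermitianWithFoldEigenvalue n k) :
    ∃ (I : ℕ) (m : Fin I → ℕ), (∀ i, 1 ≤ m i) ∧ ∑ i, m i = n ∧ (∃ i, m i = k) ∧
      A ∈ hermitianStratum n m := by
  classical
  obtain ⟨z, hz⟩ := hA
  set p := (A : Matrix (Fin n) (Fin n) ℂ).charpoly with hp
  have hmonic : p.Monic := Matrix.charpoly_monic _
  let e := p.roots.toFinset.equivFin.symm
  have hmem : ∀ w, w ∈ p.roots.toFinset ↔ 1 ≤ p.rootMultiplicity w := fun w => by
    rw [Multiset.mem_toFinset, ← Multiset.one_le_count_iff_mem, Polynomial.count_roots]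
  have hprod : p = ∏ i, (Polynomial.X - Polynomial.C (e i : ℂ)) ^ p.rootMultiplicity (e i : ℂ) := by
    rw [e.prod_comp (fun w : p.roots.toFinset =>
      (Polynomial.X - Polynomial.C (w : ℂ)) ^ p.rootMultiplicity (w : ℂ)),
      Finset.prod_coe_sort p.roots.toFinset (fun w =>
        (Polynomial.X - Polynomial.C w) ^ p.rootMultiplicity w),
      ← Polynomial.prod_multiset_root_eq_finset_root]
    exact (IsAlgClosed.splits p).eq_prod_roots_of_monic hmonic
  refine ⟨_, fun i => p.rootMultiplicity (e i : ℂ), fun i => (hmem _).1 (e i).2, ?_,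
    -- As k ≥ 1, the number z is a genuine root and so appears in the enumeration.
    ⟨e.symm ⟨z, (hmem z).2 (hz ▸ hk)⟩, by simpa using hz⟩,
    fun i => (e i : ℂ), Subtype.val_injective.comp e.injective, hprod⟩
  have hdeg : p.natDegree = n := by rw [hp, Matrix.charpoly_natDegree_eq_dim, Fintype.card_fin]
  rw [hprod, Polynomial.natDegree_prod_of_monic _ _
    fun i _ => (Polynomial.monic_X_sub_C _).pow _] at hdeg
  simpa using hdeg

theorem dimH_hermitianWithFoldEigenvalue {n k : ℕ} (hk : 1 ≤ k) (hkn : k ≤ n) :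
    dimH (hermitianWithFoldEigenvalue n k) = ((n ^ 2 - (k ^ 2 - 1) : ℕ) : ENNReal) := by
  apply le_antisymm
  · have hsub : hermitianWithFoldEigenvalue n k ⊆
        ⋃ x : {x : Σ I, (Fin I → ℕ) // (∀ i, 1 ≤ x.2 i) ∧ ∑ i, x.2 i = n ∧ ∃ i, x.2 i = k},
          hermitianStratum n x.1.2 := by
      intro A hA
      obtain ⟨I, m, h1, h2, h3, h4⟩ := exists_mem_hermitianStratum hk hA
      exact Set.mem_iUnion.2 ⟨⟨⟨I, m⟩, h1, h2, h3⟩, h4⟩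
    refine (dimH_mono hsub).trans ?_
    -- There are countably many multiplicity lists, so the dimension of the union is the supremum.
    rw [dimH_iUnion]
    refine iSup_le fun x => ?_
    rw [dimH_hermitianStratum x.2.1 x.2.2.1]
    exact_mod_cast Nat.sub_le_sub_left (sq_sub_one_le_sum x.2.2.2) _
  · have h := dimH_hermitianStratum (one_le_cons hk) (sum_cons_one hkn)
    rw [sum_cons_sq_sub_one] at h
    rw [← h]
    refine dimH_mono ?_
    rintro A ⟨μ, hμ, hchar⟩
    refine ⟨μ 0, ?_⟩
    rw [hchar, Polynomial.rootMultiplicity_prod_X_sub_C_pow hμ, Fin.cons_zero]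

theorem theorem3 (n : ℕ) :
    -- the real dimension of the space of Hermitian matrices
    Module.finrank ℝ (HermitianMatrices n) = n ^ 2 ∧
    -- dimension and codimension of the set with given multiplicities
    (∀ (I : ℕ) (k : Fin I → ℕ), (∀ i, 1 ≤ k i) → ∑ i, k i = n →
      (hermitianStratum n k).Nonempty ∧
      ∑ i, (k i ^ 2 - 1) ≤ n ^ 2 ∧
      IsEmbeddedSubmanifold (hermitianStratum n k)
        (n ^ 2 - ∑ i, (k i ^ 2 - 1)) (∑ i, (k i ^ 2 - 1)) ∧
      dimH (hermitianStratum n k) = ((n ^ 2 - ∑ i, (k i ^ 2 - 1) : ℕ) : ENNReal)) ∧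
    -- a `k`-fold eigenvalue
    (∀ k : ℕ, 1 ≤ k → k ≤ n →
      -- the least codimension, when one multiplicity is `k` and the others are arbitrary
      IsLeast {c : ℕ | ∃ (I : ℕ) (m : Fin I → ℕ), (∀ i, 1 ≤ m i) ∧ ∑ i, m i = n ∧
        (∃ i, m i = k) ∧ c = ∑ i, (m i ^ 2 - 1)} (k ^ 2 - 1) ∧
      -- one `k`-fold eigenvalue, all the others simple
      (hermitianStratum n (Fin.cons k (fun _ => 1) : Fin (n - k + 1) → ℕ)).Nonempty ∧
      IsEmbeddedSubmanifold
        (hermitianStratum n (Fin.cons k (fun _ => 1) : Fin (n - k + 1) → ℕ))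
        (n ^ 2 - (k ^ 2 - 1)) (k ^ 2 - 1) ∧
      -- all Hermitian matrices with a `k`-fold eigenvalue
      dimH (hermitianWithFoldEigenvalue n k) = ((n ^ 2 - (k ^ 2 - 1) : ℕ) : ENNReal)) := by
  refine ⟨finrank_hermitianMatrices n, fun I k hpos hsum => ⟨hermitianStratum_nonempty hsum,
    sum_sq_sub_one_le hpos hsum, isEmbeddedSubmanifold_hermitianStratum hpos,
    dimH_hermitianStratum hpos hsum⟩, fun k hk hkn => ⟨⟨?_, ?_⟩,
    hermitianStratum_nonempty (sum_cons_one hkn), ?_, dimH_hermitianWithFoldEigenvalue hk hkn⟩⟩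
  · exact ⟨_, _, one_le_cons hk, sum_cons_one hkn, ⟨0, rfl⟩, (sum_cons_sq_sub_one k _).symm⟩
  · rintro c ⟨I, m, -, -, h, rfl⟩
    exact sq_sub_one_le_sum h
  · have h := isEmbeddedSubmanifold_hermitianStratum (n := n) (one_le_cons (N := n - k) hk)
    rwa [sum_cons_sq_sub_one] at h
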